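/- Let $\mathbb K\in\{\mathbb R,\mathbb C\}$, let $-\infty<a<b<\infty$, let $m\ge 0$ be an integer and let $1\le p<\infty$. For $1\le r<\infty$ let $W^{m,r}(a,b)$ be the Sobolev space of all (classes of) functions $u\in L_r(a,b)$ with values in $\mathbb K$ such that for each $j\in\{1,\dots,m\}$ there is $u^{(j)}\in L_r(a,b)$ with $$\int_a^b u\,\phi^{(j)}=(-1)^j\int_a^b u^{(j)}\phi\qquad\text{for all }\phi\in C_c^\infty(a,b),$$ endowed with the norm $\|u\|_{m,r}=\|u\|_r+\sum_{j=1}^m\|u^{(j)}\|_r$. For cardinals $\alpha,\beta$, a subset $A$ of a topological vector space $E$ is called $(\alpha,\beta)$-spaceable if $A\cup\{0\}$ contains an $\alpha$-dimensional vector subspace of $E$ and, for every $\alpha$-dimensional vector subspace $F\subset A\cup\{0\}$ of $E$, there is a closed $\beta$-dimensional vector subspace $G$ of $E$ with $F\subset G\subset A\cup\{0\}$. Let $\mathfrak c$ denote the cardinality of $\mathbb R$. Then, for every cardinal $\alpha$, the set $$W^{m,p}(a,b)\smallsetminus\bigcup_{q\in(p,\infty)}W^{m,q}(a,b)$$ is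 $(\alpha,\mathfrak c)$-spaceable in $W^{m,p}(a,b)$ if and only if $\alpha<\aleph_0$. -/

import Mathlib

open MeasureTheory

noncomputable section

/-! ### Lineability and spaceability -/

section Spaceability

variable (K : Type*) {E : Type*} [Field K] [AddCommGroup E] [Module K E]

/-- `A` is `β`-lineable: `A ∪ {0}` contains a vector subspace of dimension `β`. -/
def IsLineable (β : Cardinal) (A : Set E) : Prop :=
  ∃ F : Submodule K E, Module.rank K F = β ∧ (F : Set E) ⊆ A ∪ {0}

/-- `A` is `(α, β)`-spaceable: it is `α`-lineable, and every `α`-dimensional subspace contained in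
`A ∪ {0}` is contained in a closed `β`-dimensional subspace which is itself contained in
`A ∪ {0}`. (The notion is usually considered for `α < β` only; the definition makes sense, and is
used here, for arbitrary cardinals.) -/
def IsPairSpaceable [TopologicalSpace E] (α β : Cardinal) (A : Set E) : Prop :=
  IsLineable K α A ∧
    ∀ F : Submodule K E, Module.rank K F = α → (F : Set E) ⊆ A ∪ {0} →
      ∃ G : Submodule K E, Module.rank K G = β ∧ IsClosed (G : Set E) ∧
        F ≤ G ∧ (G : Set E) ⊆ A ∪ {0}

end Spaceability

/-! ### Sobolev spaces on an interval -/

/-- Lebesgue measure on the open interval `(a, b)`. -/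
abbrev intervalMeasure (a b : ℝ) : Measure ℝ := volume.restrict (Set.Ioo a b)

/-- `φ ∈ C_c^∞(a, b)`. -/
structure IsTestFunction (a b : ℝ) (φ : ℝ → ℝ) : Prop where
  contDiff : ContDiff ℝ (⊤ : ℕ∞) φ
  hasCompactSupport : HasCompactSupport φ
  tsupport_subset : tsupport φ ⊆ Set.Ioo a b

section Sobolev

variable {𝕜 : Type*} [RCLike 𝕜]

/-- `g` is a weak derivative of order `j` of `u` on `(a, b)`. -/
def IsWeakDeriv (a b : ℝ) (j : ℕ) (u g : ℝ → 𝕜) : Prop :=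
  ∀ φ : ℝ → ℝ, IsTestFunction a b φ →
    ∫ x in Set.Ioo a b, iteratedDeriv j φ x • u x =
      (-1 : 𝕜) ^ j * ∫ x in Set.Ioo a b, φ x • g x

/-- (The class of) `u` belongs to `W^{m,p}(a, b)`. -/
def MemSobolev (m : ℕ) (p : ENNReal) (a b : ℝ) (u : ℝ → 𝕜) : Prop :=
  MemLp u p (intervalMeasure a b) ∧
    ∀ j ∈ Finset.Icc 1 m, ∃ g : ℝ → 𝕜, MemLp g p (intervalMeasure a b) ∧ IsWeakDeriv a b j u g

theorem IsTestFunction.integrable_iteratedDeriv_smul {a b : ℝ} {φ : ℝ → ℝ}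
    (hφ : IsTestFunction a b φ) {p : ENNReal} (hp : 1 ≤ p) {u : ℝ → 𝕜}
    (hu : MemLp u p (intervalMeasure a b)) (j : ℕ) :
    Integrable (fun x => iteratedDeriv j φ x • u x) (intervalMeasure a b) := by
  have hc : Continuous (iteratedDeriv j φ) :=
    hφ.contDiff.continuous_iteratedDeriv j (by exact_mod_cast le_top)
  have hs : HasCompactSupport (iteratedDeriv j φ) := by
    have h := hφ.hasCompactSupport.iteratedFDeriv (𝕜 := ℝ) j
    exact h.comp_left (g := fun T : ContinuousMultilinearMap ℝ (fun _ : Fin j => ℝ) ℝ =>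
      T fun _ => 1) rfl
  obtain ⟨C, hC⟩ := hc.bounded_above_of_compact_support hs
  exact (hu.integrable hp).bdd_smul C hc.aestronglyMeasurable (Filter.Eventually.of_forall hC)

theorem IsTestFunction.integrable_smul {a b : ℝ} {φ : ℝ → ℝ}
    (hφ : IsTestFunction a b φ) {p : ENNReal} (hp : 1 ≤ p) {u : ℝ → 𝕜}
    (hu : MemLp u p (intervalMeasure a b)) :
    Integrable (fun x => φ x • u x) (intervalMeasure a b) := by
  simpa using hφ.integrable_iteratedDeriv_smul hp hu 0

theorem IsWeakDeriv.congr {a b : ℝ} {j : ℕ} {u u' g g' : ℝ → 𝕜} (h : IsWeakDeriv a b j u g)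
    (hu : u =ᵐ[intervalMeasure a b] u') (hg : g =ᵐ[intervalMeasure a b] g') :
    IsWeakDeriv a b j u' g' := by
  intro φ hφ
  have h1 : ∫ x in Set.Ioo a b, iteratedDeriv j φ x • u x =
      ∫ x in Set.Ioo a b, iteratedDeriv j φ x • u' x :=
    integral_congr_ae (hu.mono fun x hx => by simp only [hx])
  have h2 : ∫ x in Set.Ioo a b, φ x • g x = ∫ x in Set.Ioo a b, φ x • g' x :=
    integral_congr_ae (hg.mono fun x hx => by simp only [hx])
  rw [← h1, ← h2]
  exact h φ hφ

theorem IsWeakDeriv.add {a b : ℝ} {p : ENNReal} (hp : 1 ≤ p) {j : ℕ} {u v g h : ℝ → 𝕜}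
    (hu : MemLp u p (intervalMeasure a b)) (hv : MemLp v p (intervalMeasure a b))
    (hg : MemLp g p (intervalMeasure a b)) (hh : MemLp h p (intervalMeasure a b))
    (hug : IsWeakDeriv a b j u g) (hvh : IsWeakDeriv a b j v h) :
    IsWeakDeriv a b j (u + v) (g + h) := by
  intro φ hφ
  simp only [Pi.add_apply, smul_add]
  rw [integral_add (hφ.integrable_iteratedDeriv_smul hp hu j)
      (hφ.integrable_iteratedDeriv_smul hp hv j),
    integral_add (hφ.integrable_smul hp hg) (hφ.integrable_smul hp hh), hug φ hφ, hvh φ hφ,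
    mul_add]

theorem IsWeakDeriv.const_smul {a b : ℝ} {j : ℕ} {u g : ℝ → 𝕜} (c : 𝕜)
    (hug : IsWeakDeriv a b j u g) : IsWeakDeriv a b j (c • u) (c • g) := by
  intro φ hφ
  simp only [Pi.smul_apply, smul_comm _ c]
  rw [integral_smul, integral_smul, hug φ hφ, smul_eq_mul, smul_eq_mul]
  ring

theorem IsWeakDeriv.unique {a b : ℝ} {p : ENNReal} (hp : 1 ≤ p) {j : ℕ} {u g h : ℝ → 𝕜}
    (hg : MemLp g p (intervalMeasure a b)) (hh : MemLp h p (intervalMeasure a b))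
    (hug : IsWeakDeriv a b j u g) (huh : IsWeakDeriv a b j u h) :
    g =ᵐ[intervalMeasure a b] h := by
  have key := isOpen_Ioo.ae_eq_zero_of_integral_contDiff_smul_eq_zero (μ := volume)
    (U := Set.Ioo a b) (f := g - h)
    (IntegrableOn.locallyIntegrableOn ((hg.sub hh).integrable hp)) ?_
  · refine (ae_restrict_iff' measurableSet_Ioo).2 (key.mono fun x hx hxm => ?_)
    exact sub_eq_zero.1 (hx hxm)
  · intro φ h1 h2 h3
    have hφ : IsTestFunction a b φ := ⟨h1, h2, h3⟩
    have e : ∫ x in Set.Ioo a b, φ x • g x = ∫ x in Set.Ioo a b, φ x • h x :=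
      mul_left_cancel₀ (pow_ne_zero j (neg_ne_zero.2 one_ne_zero))
        ((hug φ hφ).symm.trans (huh φ hφ))
    rw [← setIntegral_eq_integral_of_forall_compl_eq_zero (s := Set.Ioo a b)]
    · simp only [Pi.sub_apply, smul_sub]
      rw [integral_sub (hφ.integrable_smul hp hg) (hφ.integrable_smul hp hh), e, sub_self]
    · intro x hx
      rw [image_eq_zero_of_notMem_tsupport fun hx' => hx (h3 hx'), zero_smul]

variable (𝕜) in
/-- `W^{m,p}(a, b)` as a vector subspace of `L_p(a, b)`. -/
def sobolevSubmodule (m : ℕ) (p : ENNReal) [hp : Fact (1 ≤ p)] (a b : ℝ) :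
    Submodule 𝕜 (Lp 𝕜 p (intervalMeasure a b)) where
  carrier := {u | MemSobolev m p a b (u : ℝ → 𝕜)}
  zero_mem' := by
    refine ⟨Lp.memLp _, fun j _ => ⟨0, MemLp.zero, ?_⟩⟩
    refine IsWeakDeriv.congr (u := 0) (g := 0) ?_ (Lp.coeFn_zero _ _ _).symm
      Filter.EventuallyEq.rfl
    intro φ _
    simp
  add_mem' := by
    rintro u v ⟨hu, hu'⟩ ⟨hv, hv'⟩
    refine ⟨Lp.memLp _, fun j hj => ?_⟩
    obtain ⟨g, hg, hug⟩ := hu' j hj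
    obtain ⟨h, hh, hvh⟩ := hv' j hj
    exact ⟨g + h, hg.add hh, (IsWeakDeriv.add hp.out hu hv hg hh hug hvh).congr
      (Lp.coeFn_add u v).symm Filter.EventuallyEq.rfl⟩
  smul_mem' := by
    rintro c u ⟨hu, hu'⟩
    refine ⟨Lp.memLp _, fun j hj => ?_⟩
    obtain ⟨g, hg, hug⟩ := hu' j hj
    exact ⟨c • g, hg.const_smul c, (hug.const_smul c).congr
      (Lp.coeFn_smul c u).symm Filter.EventuallyEq.rfl⟩

variable (𝕜) in
/-- The Sobolev space `W^{m,p}(a, b)`; it is a type of its own, so that it carries the Sobolev norm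
and not the norm of `L_p(a, b)`. -/
def SobolevSpace (m : ℕ) (p : ENNReal) [Fact (1 ≤ p)] (a b : ℝ) : Type _ :=
  sobolevSubmodule 𝕜 m p a b

namespace SobolevSpace

variable {m : ℕ} {p : ENNReal} [hp : Fact (1 ≤ p)] {a b : ℝ}

instance : AddCommGroup (SobolevSpace 𝕜 m p a b) :=
  inferInstanceAs (AddCommGroup (sobolevSubmodule 𝕜 m p a b))

instance : Module 𝕜 (SobolevSpace 𝕜 m p a b) :=
  inferInstanceAs (Module 𝕜 (sobolevSubmodule 𝕜 m p a b))

/-- The inclusion of `W^{m,p}(a, b)` in `L_p(a, b)`. -/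
def toLp : SobolevSpace 𝕜 m p a b →ₗ[𝕜] Lp 𝕜 p (intervalMeasure a b) :=
  (sobolevSubmodule 𝕜 m p a b).subtype

theorem toLp_injective : Function.Injective (toLp (𝕜 := 𝕜) (m := m) (p := p) (a := a) (b := b)) :=
  Subtype.val_injective

theorem memSobolev (u : SobolevSpace 𝕜 m p a b) : MemSobolev m p a b (toLp u : ℝ → 𝕜) :=
  u.2

open Classical in
/-- The weak derivative `u^{(j)} ∈ L_p(a, b)` of order `j` of `u ∈ W^{m,p}(a, b)`, for
`1 ≤ j ≤ m` (for other `j` the value is irrelevant). -/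
def weakDeriv (j : ℕ) (u : SobolevSpace 𝕜 m p a b) : Lp 𝕜 p (intervalMeasure a b) :=
  if h : ∃ g : Lp 𝕜 p (intervalMeasure a b), IsWeakDeriv a b j (toLp u : ℝ → 𝕜) g then
    h.choose else 0

theorem isWeakDeriv_weakDeriv {j : ℕ} (hj : j ∈ Finset.Icc 1 m) (u : SobolevSpace 𝕜 m p a b) :
    IsWeakDeriv a b j (toLp u : ℝ → 𝕜) (weakDeriv j u) := by
  obtain ⟨g, hg, hug⟩ := u.memSobolev.2 j hj
  have h : ∃ g : Lp 𝕜 p (intervalMeasure a b), IsWeakDeriv a b j (toLp u : ℝ → 𝕜) g :=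
    ⟨hg.toLp g, hug.congr Filter.EventuallyEq.rfl hg.coeFn_toLp.symm⟩
  rw [weakDeriv, dif_pos h]
  exact h.choose_spec

theorem weakDeriv_eq {j : ℕ} (hj : j ∈ Finset.Icc 1 m) {u : SobolevSpace 𝕜 m p a b}
    {g : Lp 𝕜 p (intervalMeasure a b)} (h : IsWeakDeriv a b j (toLp u : ℝ → 𝕜) g) :
    weakDeriv j u = g :=
  Lp.ext (IsWeakDeriv.unique hp.out (Lp.memLp _) (Lp.memLp _) (isWeakDeriv_weakDeriv hj u) h)

theorem weakDeriv_add {j : ℕ} (hj : j ∈ Finset.Icc 1 m) (u v : SobolevSpace 𝕜 m p a b) :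
    weakDeriv j (u + v) = weakDeriv j u + weakDeriv j v := by
  refine weakDeriv_eq hj ?_
  rw [map_add]
  exact (IsWeakDeriv.add hp.out (Lp.memLp _) (Lp.memLp _) (Lp.memLp _) (Lp.memLp _)
    (isWeakDeriv_weakDeriv hj u) (isWeakDeriv_weakDeriv hj v)).congr
    (Lp.coeFn_add _ _).symm (Lp.coeFn_add _ _).symm

theorem weakDeriv_smul {j : ℕ} (hj : j ∈ Finset.Icc 1 m) (c : 𝕜) (u : SobolevSpace 𝕜 m p a b) :
    weakDeriv j (c • u) = c • weakDeriv j u := by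
  refine weakDeriv_eq hj ?_
  rw [map_smul]
  exact ((isWeakDeriv_weakDeriv hj u).const_smul c).congr
    (Lp.coeFn_smul _ _).symm (Lp.coeFn_smul _ _).symm

/-- `‖u‖_{m,p} = ‖u‖_p + ∑_{j=1}^m ‖u^{(j)}‖_p`. -/
instance : Norm (SobolevSpace 𝕜 m p a b) where
  norm u := ‖toLp u‖ + ∑ j ∈ Finset.Icc 1 m, ‖weakDeriv j u‖

theorem norm_def (u : SobolevSpace 𝕜 m p a b) :
    ‖u‖ = ‖toLp u‖ + ∑ j ∈ Finset.Icc 1 m, ‖weakDeriv j u‖ := rfl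

theorem normCore : NormedSpace.Core 𝕜 (SobolevSpace 𝕜 m p a b) where
  norm_nonneg u := by rw [norm_def]; positivity
  norm_smul c u := by
    rw [norm_def, norm_def, map_smul, norm_smul, mul_add, Finset.mul_sum]
    congr 1
    exact Finset.sum_congr rfl fun j hj => by rw [weakDeriv_smul hj, norm_smul]
  norm_triangle u v := by
    have h : ∑ j ∈ Finset.Icc 1 m, ‖weakDeriv j (u + v)‖ ≤
        ∑ j ∈ Finset.Icc 1 m, ‖weakDeriv j u‖ + ∑ j ∈ Finset.Icc 1 m, ‖weakDeriv j v‖ := by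
      rw [← Finset.sum_add_distrib]
      exact Finset.sum_le_sum fun j hj => by rw [weakDeriv_add hj]; exact norm_add_le _ _
    have h' := norm_add_le (toLp u) (toLp v)
    rw [norm_def, norm_def, norm_def, map_add]
    linarith
  norm_eq_zero_iff u := by
    constructor
    · intro h
      have h2 : 0 ≤ ∑ j ∈ Finset.Icc 1 m, ‖weakDeriv j u‖ := by positivity
      have h3 : ‖toLp u‖ = 0 := le_antisymm (by rw [norm_def] at h; linarith) (norm_nonneg _)
      exact toLp_injective (by rw [norm_eq_zero.1 h3, map_zero])
    · rintro rfl
      rw [norm_def, map_zero, norm_zero, zero_add]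
      refine Finset.sum_eq_zero fun j hj => ?_
      rw [← zero_smul 𝕜 (0 : SobolevSpace 𝕜 m p a b), weakDeriv_smul hj, zero_smul, norm_zero]

instance : NormedAddCommGroup (SobolevSpace 𝕜 m p a b) :=
  NormedAddCommGroup.ofCore normCore

instance : NormedSpace 𝕜 (SobolevSpace 𝕜 m p a b) :=
  NormedSpace.ofCore normCore

end SobolevSpace

end Sobolev

end

/-! ### Complements of subspaces in normed spaces -/

section Abstract

variable {𝕜 E : Type*} [RCLike 𝕜] [NormedAddCommGroup E] [NormedSpace 𝕜 E]

/-! On a bounded interval the spaces $W^{m,q}$ decrease in $q$, so their union over $q>p$ is a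
subspace $Y$, and the set in question is its complement. Everything follows from a closed $\mathfrak
c$-dimensional $H$ with $H\cap Y=0$, together with $Y\ne0$ (`isPairSpaceable_compl_submodule_iff`).

If $F$ is finite-dimensional and $F\cap Y=0$, then $H\cap(F+Y)$ is finite-dimensional; with a closed
complement $H_1$ of it in $H$, the space $G=F+H_1$ works. If $F$ is infinite-dimensional, take an
unbounded functional $\varphi$ on $F$ and $0\ne h\in Y$: the space $\{y+\varphi(y)h\}$ still meets
$Y$ trivially and has the dimension of $F$, but its closure contains $h$, so no closed $G$ can
contain it.

To build $H$, cut $(a,b)$ into pieces of measure $(b-a)/2^{i+1}$ and give them heights whose $p$-th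
powers are summable against these measures, but whose $q$-th powers are not for any $q>p$. A pairing
function splits the pieces into infinitely many infinite classes, each with a free coefficient. The
resulting functions in $L_p$ form a closed $\mathfrak c$-dimensional subspace, which the $m$-fold
primitive, a closed embedding, carries into $W^{m,p}$. -/

theorem Submodule.coe_subset_compl_union_zero_iff {G Y : Submodule 𝕜 E} :
    (G : Set E) ⊆ (Y : Set E)ᶜ ∪ {0} ↔ Disjoint G Y := by
  rw [Submodule.disjoint_def]
  constructor
  · intro h x hG hY
    rcases h hG with h | h
    · exact absurd hY h
    · exact h
  · intro h x hG
    by_cases hY : x ∈ Y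
    · exact Or.inr (h x hG hY)
    · exact Or.inl hY

/-- A subspace which meets `Y` trivially meets `F + Y` in a finite-dimensional space, if `F` is
finite-dimensional. -/
theorem Submodule.finiteDimensional_comap_subtype_sup {H F Y : Submodule 𝕜 E}
    [FiniteDimensional 𝕜 F] (hHY : Disjoint H Y) :
    FiniteDimensional 𝕜 ((F ⊔ Y).comap H.subtype) := by
  -- The quotient map by `Y` is injective on `H`, and sends `F ⊔ Y` into the image of `F`.
  let f : ((F ⊔ Y).comap H.subtype) →ₗ[𝕜] (E ⧸ Y) :=
    Y.mkQ ∘ₗ H.subtype ∘ₗ ((F ⊔ Y).comap H.subtype).subtype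
  have hf : ∀ x, f x ∈ F.map Y.mkQ := by
    rintro ⟨⟨x, hxH⟩, hx⟩
    obtain ⟨y, hy, z, hz, rfl⟩ := Submodule.mem_sup.1 hx
    refine ⟨y, hy, ?_⟩
    simp [f, (Submodule.Quotient.mk_eq_zero Y).2 hz]
  refine FiniteDimensional.of_injective (f.codRestrict (F.map Y.mkQ) hf) ?_
  rw [injective_iff_map_eq_zero]
  rintro ⟨⟨x, hxH⟩, hx⟩ h
  have h' : Y.mkQ x = 0 := congrArg Subtype.val h
  have hxY : x ∈ Y := by simpa using h'
  ext
  exact Submodule.disjoint_def.1 hHY x hxH hxY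

/-- If a closed subspace `H` of infinite dimension `β` meets `Y` trivially, then every
finite-dimensional space which meets `Y` trivially is contained in such a space. -/
theorem Submodule.exists_isClosed_disjoint_of_finiteDimensional {β : Cardinal}
    (hβ : Cardinal.aleph0 ≤ β) {H Y : Submodule 𝕜 E} (hHc : IsClosed (H : Set E))
    (hHr : Module.rank 𝕜 H = β) (hHY : Disjoint H Y) {F : Submodule 𝕜 E}
    [FiniteDimensional 𝕜 F] (hFY : Disjoint F Y) :
    ∃ G : Submodule 𝕜 E, Module.rank 𝕜 G = β ∧ IsClosed (G : Set E) ∧ F ≤ G ∧ Disjoint G Y := by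
  have hD := Submodule.finiteDimensional_comap_subtype_sup (F := F) hHY
  obtain ⟨H₁, hH₁c, hH₁⟩ := (Submodule.ClosedComplemented.of_finiteDimensional
    ((F ⊔ Y).comap H.subtype)).exists_isClosed_isCompl
  have hc : IsClosed ((H₁.map H.subtype : Submodule 𝕜 E) : Set E) := by
    rw [Submodule.map_coe]
    exact hHc.isClosedEmbedding_subtypeVal.isClosedMap _ hH₁c
  have hr : Module.rank 𝕜 (H₁.map H.subtype) = β := by
    rw [← (Submodule.equivMapOfInjective H.subtype H.subtype_injective H₁).rank_eq]
    have h := Submodule.rank_sup_add_rank_inf_eq ((F ⊔ Y).comap H.subtype) H₁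
    rw [hH₁.sup_eq_top, hH₁.inf_eq_bot, rank_top, rank_bot, add_zero, hHr] at h
    have hlt : Module.rank 𝕜 ((F ⊔ Y).comap H.subtype) < Cardinal.aleph0 :=
      Module.rank_lt_aleph0 _ _
    exact (Cardinal.eq_of_add_eq_of_aleph0_le h.symm (hlt.trans_le hβ) hβ)
  refine ⟨F ⊔ H₁.map H.subtype, le_antisymm ?_ ?_, ?_, le_sup_left, ?_⟩
  · refine (Submodule.rank_add_le_rank_add_rank _ _).trans ?_
    rw [hr]
    exact Cardinal.add_le_of_le hβ ((Module.rank_lt_aleph0 𝕜 F).le.trans hβ) le_rfl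
  · rw [← hr]
    exact Submodule.rank_mono le_sup_right
  · rw [sup_comm]
    exact Submodule.isClosed_sup_finiteDimensional _ _ hc
  · rw [Submodule.disjoint_def]
    intro x hx hxY
    obtain ⟨f, hf, h, ⟨h', hh', rfl⟩, rfl⟩ := Submodule.mem_sup.1 hx
    have h1 : H.subtype h' ∈ F ⊔ Y := by
      have : H.subtype h' = -f + (f + H.subtype h') := by abel
      rw [this]
      exact Submodule.add_mem_sup (neg_mem hf) hxY
    have h2 : h' = 0 := Submodule.disjoint_def.1 hH₁.disjoint h' h1 hh'
    subst h2
    rw [map_zero, add_zero] at hxY ⊢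
    exact Submodule.disjoint_def.1 hFY f hf hxY

/-- An infinite-dimensional normed space carries a linear functional which is not bounded. -/
theorem exists_linearMap_tendsto_zero_of_aleph0_le_rank
    (h : Cardinal.aleph0 ≤ Module.rank 𝕜 E) :
    ∃ (φ : E →ₗ[𝕜] 𝕜) (x : ℕ → E), (∀ n, φ (x n) = 1) ∧
      Filter.Tendsto x Filter.atTop (nhds 0) := by
  let B := Module.Basis.ofVectorSpace 𝕜 E
  have hinf : Infinite (Module.Basis.ofVectorSpaceIndex 𝕜 E) := by
    rw [Cardinal.infinite_iff, B.mk_eq_rank'']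
    exact h
  let e := Infinite.natEmbedding (Module.Basis.ofVectorSpaceIndex 𝕜 E)
  -- Prescribing the value `d n` at `B (e n)` makes `(d n)⁻¹ • B (e n)` a vector of value 1 and norm
  -- at most `1 / (n + 1)`.
  let d : ℕ → 𝕜 := fun n => ((n + 1 : ℝ) * (‖B (e n)‖ + 1) : ℝ)
  have hd : ∀ n, d n ≠ 0 := fun n => by
    simp only [d, ne_eq, RCLike.ofReal_eq_zero]
    positivity
  refine ⟨B.constr 𝕜 (Function.extend e d 0), fun n => (d n)⁻¹ • B (e n), fun n => ?_, ?_⟩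
  · rw [map_smul, Module.Basis.constr_basis, e.injective.extend_apply, smul_eq_mul,
      inv_mul_cancel₀ (hd n)]
  · refine squeeze_zero_norm (fun n => ?_) tendsto_one_div_add_atTop_nhds_zero_nat
    have h1 : ‖d n‖ = (n + 1 : ℝ) * (‖B (e n)‖ + 1) := by
      rw [RCLike.norm_ofReal, abs_of_nonneg (by positivity)]
    rw [norm_smul, norm_inv, h1, mul_inv, one_div, mul_assoc]
    refine mul_le_of_le_one_right (by positivity) ?_
    rw [inv_mul_le_one₀ (by positivity)]
    linarith

/-- Every infinite-dimensional space which meets `Y ≠ 0` trivially may be replaced by a space of the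
same dimension whose closure meets `Y`. -/
theorem Submodule.exists_disjoint_rank_eq_mem_closure {F Y : Submodule 𝕜 E}
    (hF : Cardinal.aleph0 ≤ Module.rank 𝕜 F) (hFY : Disjoint F Y) {h : E} (hY : h ∈ Y) :
    ∃ F' : Submodule 𝕜 E, Module.rank 𝕜 F' = Module.rank 𝕜 F ∧ Disjoint F' Y ∧
      h ∈ closure (F' : Set E) := by
  obtain ⟨φ, x, hφx, hx⟩ := exists_linearMap_tendsto_zero_of_aleph0_le_rank hF
  -- Since `h ∈ Y`, this shear is the inclusion modulo `Y`; hence `T y ∈ Y` forces `y ∈ F ⊓ Y`.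
  let T : F →ₗ[𝕜] E := F.subtype + φ.smulRight h
  have hT : ∀ y, T y = y + φ y • h := fun y => rfl
  have key : ∀ y, T y ∈ Y → y = 0 := by
    intro y hy
    rw [hT, Submodule.add_mem_iff_left _ (Y.smul_mem _ hY)] at hy
    exact Subtype.ext (Submodule.disjoint_def.1 hFY y y.2 hy)
  have hTinj : Function.Injective T := by
    rw [injective_iff_map_eq_zero]
    intro y hy
    exact key y (by rw [hy]; exact Y.zero_mem)
  refine ⟨LinearMap.range T, rank_range_of_injective T hTinj, ?_, ?_⟩
  · rw [Submodule.disjoint_def]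
    rintro _ ⟨y, rfl⟩ hy
    rw [key y hy, map_zero]
  · refine mem_closure_of_tendsto (f := fun n => T (x n)) (b := Filter.atTop) ?_
      (Filter.Eventually.of_forall fun n => ⟨x n, rfl⟩)
    have h1 : Filter.Tendsto (fun n => (x n : E)) Filter.atTop (nhds 0) :=
      (continuous_subtype_val.tendsto (0 : F)).comp hx
    simpa [hT, hφx] using h1.add_const h

/-- Criterion for the spaceability of the complement of a subspace. -/
theorem isPairSpaceable_compl_submodule_iff {β : Cardinal} (hβ : Cardinal.aleph0 ≤ β)
    {H Y : Submodule 𝕜 E} (hHc : IsClosed (H : Set E)) (hHr : Module.rank 𝕜 H = β)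
    (hHY : Disjoint H Y) (hY : Y ≠ ⊥) (α : Cardinal) :
    IsPairSpaceable 𝕜 α β (Y : Set E)ᶜ ↔ α < Cardinal.aleph0 := by
  simp only [IsPairSpaceable, IsLineable, Submodule.coe_subset_compl_union_zero_iff]
  constructor
  · rintro ⟨⟨F, hFα, hFY⟩, hs⟩
    by_contra! hα
    obtain ⟨h, hhY, hh0⟩ := Submodule.exists_mem_ne_zero_of_ne_bot hY
    obtain ⟨F', hF'r, hF'Y, hF'h⟩ :=
      Submodule.exists_disjoint_rank_eq_mem_closure (hα.trans_eq hFα.symm) hFY hhY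
    obtain ⟨G, -, hGc, hFG, hGY⟩ := hs F' (hF'r.trans hFα) hF'Y
    exact hh0 (Submodule.disjoint_def.1 hGY h (closure_minimal hFG hGc hF'h) hhY)
  · intro hα
    refine ⟨?_, fun F hF hFY => ?_⟩
    · obtain ⟨s, hs, hsi⟩ := (le_rank_iff_exists_linearIndependent (K := 𝕜) (V := H)).1
        (hα.le.trans (hβ.trans_eq hHr.symm))
      refine ⟨(Submodule.span 𝕜 s).map H.subtype, ?_, hHY.mono_left (Submodule.map_subtype_le _ _)⟩
      rw [← (Submodule.equivMapOfInjective H.subtype H.subtype_injective _).rank_eq,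
        rank_span_set hsi, hs]
    · have : FiniteDimensional 𝕜 F := Module.rank_lt_aleph0_iff.1 (hF.trans_lt hα)
      exact Submodule.exists_isClosed_disjoint_of_finiteDimensional hβ hHc hHr hHY hFY

end Abstract

/-! ### Dyadic partition of the interval -/

section DyadicIndex

/-- Within $(a,b)$, the integer part of $-\log_2\frac{x-a}{b-a}$ equals $i$ exactly on the dyadic
interval from $a+(b-a)/2^{i+1}$ (excluded) to $a+(b-a)/2^i$ (included). -/
theorem exists_measurable_nat_intervalMeasure_preimage {a b : ℝ} (hab : a < b) :
    ∃ κ : ℝ → ℕ, Measurable κ ∧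
      ∀ i, intervalMeasure a b (κ ⁻¹' {i}) = ENNReal.ofReal ((b - a) / 2 ^ (i + 1)) := by
  have hd : 0 < b - a := sub_pos.2 hab
  refine ⟨fun x => ⌊-Real.logb 2 ((x - a) / (b - a))⌋₊, ?_, fun i => ?_⟩
  · unfold Real.logb
    fun_prop
  have hpow : ∀ n : ℕ, (2 : ℝ) ^ (-(n : ℝ)) = 1 / 2 ^ n := fun n => by
    rw [Real.rpow_neg (by norm_num), Real.rpow_natCast, one_div]
  have key : ∀ x ∈ Set.Ioo a b, (⌊-Real.logb 2 ((x - a) / (b - a))⌋₊ = i ↔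
      x ∈ Set.Ioc (a + (b - a) / 2 ^ (i + 1)) (a + (b - a) / 2 ^ i)) := by
    intro x hx
    have hy0 : 0 < (x - a) / (b - a) := div_pos (sub_pos.2 hx.1) hd
    have hy1 : (x - a) / (b - a) < 1 := by
      rw [div_lt_one hd]
      linarith [hx.2]
    have hl : Real.logb 2 ((x - a) / (b - a)) < 0 := Real.logb_neg (by norm_num) hy0 hy1
    rw [Nat.floor_eq_iff (by linarith), Set.mem_Ioc, and_comm, le_neg, neg_lt,
      Real.logb_le_iff_le_rpow (by norm_num) hy0, hpow,
      Real.lt_logb_iff_rpow_lt (by norm_num) hy0, ← Nat.cast_succ, hpow]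
    refine and_congr ?_ ?_
    · rw [lt_div_iff₀ hd, one_div_mul_eq_div, lt_sub_iff_add_lt']
    · rw [div_le_iff₀ hd, one_div_mul_eq_div, sub_le_iff_le_add']
  have hlen : (a + (b - a) / 2 ^ i) - (a + (b - a) / 2 ^ (i + 1)) = (b - a) / 2 ^ (i + 1) := by
    rw [pow_succ]
    field_simp
    ring
  rw [Measure.restrict_apply' measurableSet_Ioo]
  refine le_antisymm ?_ ?_
  · rw [← hlen, ← Real.volume_Ioc]
    exact measure_mono fun x hx => (key x hx.2).1 hx.1
  -- The open interval avoids the right endpoint, which for `i = 0` is `b` and lies outside `Ioo a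
  -- b`.
  · rw [← hlen, ← Real.volume_Ioo]
    refine measure_mono fun x hx => ?_
    have h1 : 0 < (b - a) / 2 ^ (i + 1) := by positivity
    have h2 : (b - a) / 2 ^ i ≤ b - a := div_le_self hd.le (one_le_pow₀ (by norm_num))
    have hx' : x ∈ Set.Ioo a b := ⟨by linarith [hx.1], by linarith [hx.2]⟩
    exact ⟨(key x hx').2 ⟨hx.1, hx.2.le⟩, hx'⟩

end DyadicIndex

/-! ### Step functions in $L_p$ and in no $L_q$, $p<q<\infty$ -/

section StepFunctions

theorem lintegral_comp_nat {X : Type*} [MeasurableSpace X] {μ : Measure X} {κ : X → ℕ}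
    (hκ : Measurable κ) (F : ℕ → ENNReal) :
    ∫⁻ x, F (κ x) ∂μ = ∑' i, F i * μ (κ ⁻¹' {i}) := by
  rw [← lintegral_map (measurable_of_countable F) hκ, lintegral_countable']
  simp_rw [Measure.map_apply hκ (measurableSet_singleton _)]

/-- `2^i / (i+1)^2` to the power `1/p`. -/
noncomputable def stepWeight (p : ENNReal) (i : ℕ) : ℝ :=
  (2 ^ i / ((i : ℝ) + 1) ^ 2) ^ (1 / p.toReal)

theorem stepWeight_pos (p : ENNReal) (i : ℕ) : 0 < stepWeight p i :=
  Real.rpow_pos_of_pos (by positivity) _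

theorem stepWeight_rpow (p : ENNReal) (i : ℕ) (r : ℝ) :
    stepWeight p i ^ r = (2 ^ i / ((i : ℝ) + 1) ^ 2) ^ (r / p.toReal) := by
  rw [stepWeight, ← Real.rpow_mul (by positivity), one_div_mul_eq_div]

/-- With $t=r/p>1$ the expression is $\frac d2\,2^{i(t-1)}/(i+1)^{2t}$: exponential growth beats the
power. -/
theorem tendsto_stepWeight_rpow_mul_atTop {p : ENNReal} {r d : ℝ} (hp : 0 < p.toReal)
    (hr : p.toReal < r) (hd : 0 < d) :
    Filter.Tendsto (fun i : ℕ => stepWeight p i ^ r * (d / 2 ^ (i + 1))) Filter.atTop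
      Filter.atTop := by
  set t := r / p.toReal with ht
  have ht1 : 1 < t := (one_lt_div hp).2 hr
  have hb : 0 < Real.log 2 * (t - 1) := mul_pos (Real.log_pos (by norm_num)) (by linarith)
  have h1 := (tendsto_exp_mul_div_rpow_atTop (2 * t) _ hb).comp
    (Filter.tendsto_atTop_add_const_right _ (1 : ℝ) tendsto_natCast_atTop_atTop)
  -- The exponential factor compensates for evaluating the limit `h1` at `i + 1`.
  have hC : 0 < d / 2 * Real.exp (-(Real.log 2 * (t - 1))) := by positivity
  refine (h1.const_mul_atTop hC).congr fun i => ?_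
  have hi : (0 : ℝ) < (i : ℝ) + 1 := by positivity
  have h2 : (2 : ℝ) ^ i = Real.exp (Real.log 2 * i) := by
    rw [← Real.rpow_natCast, Real.rpow_def_of_pos (by norm_num)]
  rw [stepWeight_rpow, ← ht, Real.div_rpow (by positivity) (by positivity), pow_succ 2 i, h2,
    ← Real.exp_mul, ← Real.rpow_natCast ((i : ℝ) + 1) 2, ← Real.rpow_mul hi.le]
  simp only [Function.comp_apply, Nat.cast_ofNat]
  have e1 : Real.exp (Real.log 2 * i * t) =
      Real.exp (-(Real.log 2 * (t - 1))) * Real.exp (Real.log 2 * (t - 1) * (i + 1)) *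
        Real.exp (Real.log 2 * i) := by
    rw [← Real.exp_add, ← Real.exp_add]
    ring_nf
  rw [e1]
  have := Real.exp_pos (Real.log 2 * i)
  have := Real.rpow_pos_of_pos hi (2 * t)
  field_simp

variable {𝕜 X : Type*} [RCLike 𝕜] {κ : X → ℕ} {p : ENNReal}

variable (p) in
/-- The function which is `stepWeight p i * c k` on `κ = i`, where `k` is the first component of
the pair with number `i`. -/
noncomputable def stepFunction (κ : X → ℕ) (c : ℕ → 𝕜) (x : X) : 𝕜 :=
  (stepWeight p (κ x) : 𝕜) * c (Nat.unpair (κ x)).1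

theorem stepFunction_add (c c' : ℕ → 𝕜) :
    stepFunction p κ (c + c') = stepFunction p κ c + stepFunction p κ c' := by
  ext x
  simp [stepFunction, mul_add]

theorem stepFunction_smul (z : 𝕜) (c : ℕ → 𝕜) :
    stepFunction p κ (z • c) = z • stepFunction p κ c := by
  ext x
  simp [stepFunction, mul_left_comm]

theorem enorm_stepFunction_rpow (c : ℕ → 𝕜) (x : X) {r : ℝ} (hr : 0 ≤ r) :
    ‖stepFunction p κ c x‖ₑ ^ r =
      ENNReal.ofReal (stepWeight p (κ x) ^ r) * ‖c (Nat.unpair (κ x)).1‖ₑ ^ r := by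
  rw [stepFunction, enorm_mul, ENNReal.mul_rpow_of_nonneg _ _ hr,
    ← ENNReal.ofReal_rpow_of_nonneg (stepWeight_pos p _).le hr, ← ofReal_norm,
    RCLike.norm_ofReal, abs_of_pos (stepWeight_pos p _)]

variable [MeasurableSpace X] {μ : Measure X} {d : ℝ}

theorem measurable_stepFunction (hκ : Measurable κ) (c : ℕ → 𝕜) :
    Measurable (stepFunction p κ c) :=
  (measurable_of_countable fun i : ℕ => (stepWeight p i : 𝕜) * c (Nat.unpair i).1).comp hκ

/-- The piece `κ = i` contributes at most $\frac d2(i+1)^{-2}$ to the integral of the $p$-th power.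
-/
theorem memLp_stepFunction_of_norm_le_one (hp : 1 ≤ p) (hp' : p ≠ ⊤) (hκ : Measurable κ)
    (hd : 0 < d) (hμ : ∀ i, μ (κ ⁻¹' {i}) = ENNReal.ofReal (d / 2 ^ (i + 1))) {c : ℕ → 𝕜}
    (hc : ∀ k, ‖c k‖ ≤ 1) : MemLp (stepFunction p κ c) p μ := by
  have hp0 : p ≠ 0 := (zero_lt_one.trans_le hp).ne'
  have hpr : 0 < p.toReal := ENNReal.toReal_pos hp0 hp'
  refine ⟨(measurable_stepFunction hκ c).aestronglyMeasurable, ?_⟩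
  rw [eLpNorm_lt_top_iff_lintegral_rpow_enorm_lt_top hp0 hp']
  have h1 : ∀ x, ‖stepFunction p κ c x‖ₑ ^ p.toReal ≤
      (fun i => ENNReal.ofReal (stepWeight p i ^ p.toReal)) (κ x) := fun x => by
    rw [enorm_stepFunction_rpow c x hpr.le]
    refine mul_le_of_le_one_right' (ENNReal.rpow_le_one ?_ hpr.le)
    rw [← ofReal_norm]
    exact ENNReal.ofReal_le_one.2 (hc _)
  refine (lintegral_mono h1).trans_lt ?_
  rw [lintegral_comp_nat hκ fun i => ENNReal.ofReal (stepWeight p i ^ p.toReal)]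
  have hs : Summable fun i : ℕ => d / 2 * (1 / ((i : ℝ) + 1) ^ 2) := by
    refine Summable.mul_left _ ?_
    exact_mod_cast (summable_nat_add_iff 1).2 (Real.summable_one_div_nat_pow.2 one_lt_two)
  refine lt_of_eq_of_lt (tsum_congr fun i => ?_) hs.tsum_ofReal_lt_top
  rw [hμ, ← ENNReal.ofReal_mul (by have := stepWeight_pos p i; positivity), stepWeight_rpow,
    div_self hpr.ne', Real.rpow_one]
  congr 1
  rw [pow_succ 2 i]
  field_simp

/-- If `c k ≠ 0`, this coefficient occurs on all the pieces `Nat.pair k n`, whose contributions to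
the $q$-th power integral tend to infinity with `n`, whereas the terms of a convergent series tend
to 0. -/
theorem eq_zero_of_memLp_stepFunction {q : ENNReal} (hp : 1 ≤ p) (hpq : p < q) (hq : q ≠ ⊤)
    (hκ : Measurable κ) (hd : 0 < d)
    (hμ : ∀ i, μ (κ ⁻¹' {i}) = ENNReal.ofReal (d / 2 ^ (i + 1))) {c : ℕ → 𝕜}
    (hc : MemLp (stepFunction p κ c) q μ) : c = 0 := by
  have hp0 : p ≠ 0 := (zero_lt_one.trans_le hp).ne'
  have hp' : p ≠ ⊤ := hpq.ne_top
  have hpr : 0 < p.toReal := ENNReal.toReal_pos hp0 hp'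
  have hqr : p.toReal < q.toReal := (ENNReal.toReal_lt_toReal hp' hq).2 hpq
  have hq0 : 0 < q.toReal := hpr.trans hqr
  have hq1 : q ≠ 0 := (zero_le.trans_lt hpq).ne'
  have h := (eLpNorm_lt_top_iff_lintegral_rpow_enorm_lt_top hq1 hq).1 hc.2
  simp_rw [enorm_stepFunction_rpow c _ hq0.le] at h
  rw [lintegral_comp_nat hκ (fun i => ENNReal.ofReal (stepWeight p i ^ q.toReal) *
    ‖c (Nat.unpair i).1‖ₑ ^ q.toReal)] at h
  have h0 := ENNReal.tendsto_atTop_zero_of_tsum_ne_top h.ne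
  ext k
  by_contra hck
  have hpos : 0 < ‖c k‖ₑ ^ q.toReal := ENNReal.rpow_pos (enorm_pos.2 hck) enorm_ne_top
  have hpair : Filter.Tendsto (fun n => Nat.pair k n) Filter.atTop Filter.atTop :=
    Filter.tendsto_atTop_mono (fun n => Nat.right_le_pair k n) Filter.tendsto_id
  have h1 := (h0.comp hpair).eventually (gt_mem_nhds hpos)
  have h2 := ((tendsto_stepWeight_rpow_mul_atTop hpr hqr hd).comp hpair).eventually_ge_atTop 1
  obtain ⟨n, hn1, hn2⟩ := (h1.and h2).exists
  simp only [Function.comp_apply, Nat.unpair_pair] at hn1 hn2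
  rw [hμ, mul_right_comm, ← ENNReal.ofReal_mul
    (by have := stepWeight_pos p (Nat.pair k n); positivity)] at hn1
  refine absurd hn1 (not_lt.2 (le_mul_of_one_le_left' ?_))
  exact ENNReal.one_le_ofReal.2 hn2

variable (𝕜 κ p μ) in
/-- The sequences `c` for which `stepFunction p κ c` is in `L_p`. -/
def stepSequences : Submodule 𝕜 (ℕ → 𝕜) where
  carrier := {c | MemLp (stepFunction p κ c) p μ}
  zero_mem' := by
    have : stepFunction p κ (0 : ℕ → 𝕜) = 0 := by ext; simp [stepFunction]
    simp only [Set.mem_ofPred_eq, this]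
    exact MemLp.zero
  add_mem' {c c'} hc hc' := by
    simp only [Set.mem_ofPred_eq, stepFunction_add] at *
    exact hc.add hc'
  smul_mem' z c hc := by
    simp only [Set.mem_ofPred_eq, stepFunction_smul] at *
    exact hc.const_smul z

theorem memLp_stepFunction (c : stepSequences 𝕜 κ p μ) :
    MemLp (stepFunction p κ (c : ℕ → 𝕜)) p μ := c.2

variable (𝕜 κ p μ) in
/-- `c ↦ stepFunction p κ c`, as a linear map to `L_p`. -/
noncomputable def stepLp : stepSequences 𝕜 κ p μ →ₗ[𝕜] Lp 𝕜 p μ where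
  toFun c := MemLp.toLp (stepFunction p κ c) (memLp_stepFunction c)
  map_add' c c' := by
    rw [← MemLp.toLp_add]
    congr 1
    exact stepFunction_add _ _
  map_smul' z c := by
    rw [RingHom.id_apply, ← MemLp.toLp_const_smul]
    congr 1
    exact stepFunction_smul _ _

theorem coeFn_stepLp (c : stepSequences 𝕜 κ p μ) :
    stepLp 𝕜 κ p μ c =ᵐ[μ] stepFunction p κ (c : ℕ → 𝕜) :=
  MemLp.coeFn_toLp c.2

theorem eq_zero_of_memLp_stepLp {q : ENNReal} (hp : 1 ≤ p) (hpq : p < q) (hq : q ≠ ⊤)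
    (hκ : Measurable κ) (hd : 0 < d)
    (hμ : ∀ i, μ (κ ⁻¹' {i}) = ENNReal.ofReal (d / 2 ^ (i + 1))) {c : stepSequences 𝕜 κ p μ}
    (hc : MemLp (stepLp 𝕜 κ p μ c) q μ) : c = 0 :=
  Subtype.ext (eq_zero_of_memLp_stepFunction hp hpq hq hκ hd hμ
    ((memLp_congr_ae (coeFn_stepLp c)).1 hc))

/-- A property which holds almost everywhere holds at some point of `κ = i`. -/
theorem exists_of_ae_of_measure_preimage (hd : 0 < d)
    (hμ : ∀ i, μ (κ ⁻¹' {i}) = ENNReal.ofReal (d / 2 ^ (i + 1))) {P : X → Prop}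
    (hP : ∀ᵐ x ∂μ, P x) (i : ℕ) : ∃ x, κ x = i ∧ P x := by
  by_contra! h
  have h0 : μ (κ ⁻¹' {i}) = 0 := measure_mono_null (fun x hx => h x hx) hP
  rw [hμ, ENNReal.ofReal_eq_zero] at h0
  have : 0 < d / 2 ^ (i + 1) := by positivity
  linarith

theorem stepLp_injective (hd : 0 < d)
    (hμ : ∀ i, μ (κ ⁻¹' {i}) = ENNReal.ofReal (d / 2 ^ (i + 1))) :
    Function.Injective (stepLp 𝕜 κ p μ) := by
  rw [injective_iff_map_eq_zero]
  intro c hc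
  have h : stepFunction p κ (c : ℕ → 𝕜) =ᵐ[μ] 0 :=
    (coeFn_stepLp c).symm.trans (by rw [hc]; exact Lp.coeFn_zero _ _ _)
  ext k
  obtain ⟨x, hx, hxk⟩ := exists_of_ae_of_measure_preimage hd hμ h (Nat.pair k 0)
  simpa [stepFunction, hx, (stepWeight_pos p _).ne'] using hxk

/-- An $L_p$-limit is an a.e. limit along a subsequence. As each piece has positive measure,
convergence at one of its points gives convergence of the coefficient `k`, so the limit is again a
step function. -/
theorem isClosed_range_stepLp [Fact (1 ≤ p)] (hd : 0 < d)
    (hμ : ∀ i, μ (κ ⁻¹' {i}) = ENNReal.ofReal (d / 2 ^ (i + 1))) :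
    IsClosed (LinearMap.range (stepLp 𝕜 κ p μ) : Set (Lp 𝕜 p μ)) := by
  refine IsSeqClosed.isClosed fun u v hu huv => ?_
  choose c hc using hu
  obtain ⟨ns, -, hns⟩ := (tendstoInMeasure_of_tendsto_Lp huv).exists_seq_tendsto_ae
  have hall : ∀ᵐ x ∂μ, ∀ n, u n x = stepFunction p κ (c n : ℕ → 𝕜) x :=
    ae_all_iff.2 fun n => by rw [← hc n]; exact coeFn_stepLp (c n)
  have hlim : ∀ᵐ x ∂μ, Filter.Tendsto (fun n => stepFunction p κ (c (ns n) : ℕ → 𝕜) x)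
      Filter.atTop (nhds (v x)) := by
    filter_upwards [hns, hall] with x h1 h2
    simpa only [h2] using h1
  have hcl : ∀ k, ∃ l, Filter.Tendsto (fun n => (c (ns n) : ℕ → 𝕜) k) Filter.atTop (nhds l) := by
    intro k
    obtain ⟨x, hx, hxk⟩ := exists_of_ae_of_measure_preimage hd hμ hlim (Nat.pair k 0)
    have hs : (stepWeight p (Nat.pair k 0) : 𝕜) ≠ 0 :=
      RCLike.ofReal_ne_zero.2 (stepWeight_pos p _).ne'
    refine ⟨(stepWeight p (Nat.pair k 0) : 𝕜)⁻¹ * v x, (hxk.const_mul _).congr fun n => ?_⟩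
    simp [stepFunction, hx, inv_mul_cancel_left₀ hs]
  choose l hl using hcl
  have hv : v =ᵐ[μ] stepFunction p κ l := by
    filter_upwards [hlim] with x hx
    exact tendsto_nhds_unique hx ((hl _).const_mul _)
  have hlm : l ∈ stepSequences 𝕜 κ p μ := (memLp_congr_ae hv).1 (Lp.memLp v)
  exact ⟨⟨l, hlm⟩, Lp.ext ((coeFn_stepLp _).trans hv.symm)⟩

theorem RCLike.mk_le_continuum (𝕜 : Type*) [RCLike 𝕜] :
    Cardinal.mk 𝕜 ≤ Cardinal.continuum := by
  have h : Function.Injective fun z : 𝕜 => (RCLike.re z, RCLike.im z) := fun z w h =>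
    RCLike.ext (congrArg Prod.fst h) (congrArg Prod.snd h)
  have h1 := Cardinal.lift_mk_le_lift_mk_of_injective h
  rwa [Cardinal.mk_prod, Cardinal.lift_id, Cardinal.mk_real, Cardinal.continuum_mul_self,
    Cardinal.lift_continuum, Cardinal.lift_le_continuum] at h1

/-- Dedekind's independence of characters, for the monoid ℕ. -/
theorem linearIndependent_pow_nat (𝕜 : Type*) [RCLike 𝕜] :
    LinearIndependent 𝕜 fun (z : 𝕜) (n : ℕ) => z ^ n :=
  (linearIndependent_monoidHom (Multiplicative ℕ) 𝕜).comp (powersHom 𝕜) (powersHom 𝕜).injective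

/-- There are only $\mathfrak c$ sequences in all, and the geometric sequences with ratio in $[0,1]$
are bounded by 1 and independent. -/
theorem rank_stepSequences (hp : 1 ≤ p) (hp' : p ≠ ⊤) (hκ : Measurable κ) (hd : 0 < d)
    (hμ : ∀ i, μ (κ ⁻¹' {i}) = ENNReal.ofReal (d / 2 ^ (i + 1))) :
    Module.rank 𝕜 (stepSequences 𝕜 κ p μ) = Cardinal.continuum := by
  refine le_antisymm ?_ ?_
  · refine (Submodule.rank_le _).trans ((rank_le_card 𝕜 _).trans ?_)
    rw [Cardinal.mk_pi, Cardinal.prod_const, Cardinal.lift_id', Cardinal.mk_nat,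
      Cardinal.lift_aleph0, ← Cardinal.continuum_power_aleph0]
    exact Cardinal.power_le_power_right (RCLike.mk_le_continuum 𝕜)
  · let w : Set.Icc (0 : ℝ) 1 → stepSequences 𝕜 κ p μ := fun t =>
      ⟨fun n => ((t : ℝ) : 𝕜) ^ n, memLp_stepFunction_of_norm_le_one hp hp' hκ hd hμ fun k => by
        rw [norm_pow, RCLike.norm_ofReal, abs_of_nonneg t.2.1]
        exact pow_le_one₀ t.2.1 t.2.2⟩
    have hw : LinearIndependent 𝕜 w := by
      refine LinearIndependent.of_comp (Submodule.subtype _) ?_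
      refine (linearIndependent_pow_nat 𝕜).comp (fun t : Set.Icc (0 : ℝ) 1 => ((t : ℝ) : 𝕜)) ?_
      exact fun s t h => Subtype.ext (RCLike.ofReal_injective h)
    have h := hw.cardinal_lift_le_rank
    simpa [Cardinal.mk_Icc_real] using h

end StepFunctions

/-! ### Primitives and their weak derivatives -/

section Primitive

variable {𝕜 : Type*} [RCLike 𝕜] {a b : ℝ}

theorem IsTestFunction.deriv {φ : ℝ → ℝ} (hφ : IsTestFunction a b φ) :
    IsTestFunction a b (deriv φ) where
  contDiff := (contDiff_infty_iff_deriv.1 hφ.contDiff).2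
  hasCompactSupport := hφ.hasCompactSupport.deriv
  tsupport_subset := tsupport_deriv_subset.trans hφ.tsupport_subset

theorem IsTestFunction.iteratedDeriv {φ : ℝ → ℝ} (hφ : IsTestFunction a b φ) (j : ℕ) :
    IsTestFunction a b (iteratedDeriv j φ) := by
  induction j with
  | zero => simpa using hφ
  | succ j ih => rw [iteratedDeriv_succ]; exact ih.deriv

theorem IsTestFunction.setIntegral_deriv {φ : ℝ → ℝ} (hφ : IsTestFunction a b φ) {t : ℝ}
    (htb : t ≤ b) : ∫ x in Set.Ioo t b, _root_.deriv φ x = -φ t := by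
  have hb : φ b = 0 :=
    image_eq_zero_of_notMem_tsupport fun h => lt_irrefl b (hφ.tsupport_subset h).2
  rw [← integral_Ioc_eq_integral_Ioo, ← intervalIntegral.integral_of_le htb,
    intervalIntegral.integral_deriv_eq_sub
      (fun x _ => (hφ.contDiff.differentiable (by simp)).differentiableAt)
      (hφ.deriv.contDiff.continuous.intervalIntegrable _ _), hb, zero_sub]

variable (a) in
/-- The primitive of `f` which vanishes at `a`. -/
noncomputable def primitive (f : ℝ → 𝕜) (x : ℝ) : 𝕜 := ∫ t in Set.Ioo a x, f t

theorem aestronglyMeasurable_primitive {f : ℝ → 𝕜} (hf : Integrable f (intervalMeasure a b)) :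
    AEStronglyMeasurable (primitive a f) (intervalMeasure a b) := by
  have h : IntegrableOn f (Set.Icc a b) := (integrableOn_Icc_iff_integrableOn_Ioo).2 hf
  have hc := (intervalIntegral.continuousOn_primitive h).mono Set.Ioo_subset_Icc_self
  simp_rw [integral_Ioc_eq_integral_Ioo] at hc
  exact hc.aestronglyMeasurable measurableSet_Ioo

theorem eLpNorm_primitive_top_le (f : ℝ → 𝕜) :
    eLpNorm (primitive a f) ⊤ (intervalMeasure a b) ≤ eLpNorm f 1 (intervalMeasure a b) := by
  rw [eLpNorm_exponent_top]
  refine essSup_le_of_ae_le _ ?_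
  filter_upwards [ae_restrict_mem measurableSet_Ioo] with x hx
  refine (enorm_integral_le_lintegral_enorm _).trans ?_
  rw [eLpNorm_one_eq_lintegral_enorm]
  exact lintegral_mono_set (Set.Ioo_subset_Ioo_right hx.2.le)

/-- Fubini for $\varphi'(x)f(t)$ on the triangle $t<x$; the inner integral in $x$ is
$-\varphi(t)f(t)$ because $\varphi(b)=0$. -/
theorem isWeakDeriv_one_primitive {f : ℝ → 𝕜} (hf : Integrable f (intervalMeasure a b)) :
    IsWeakDeriv a b 1 (primitive a f) f := by
  intro φ hφ
  rw [iteratedDeriv_one, pow_one, neg_one_mul]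
  let S : Set (ℝ × ℝ) := {z | z.2 < z.1}
  have hS : MeasurableSet S := measurableSet_lt measurable_snd measurable_fst
  have hφ' : Integrable (deriv φ) (intervalMeasure a b) :=
    (hφ.deriv.contDiff.continuous.integrable_of_hasCompactSupport
      hφ.deriv.hasCompactSupport).restrict
  have hSint : Integrable (S.indicator fun z : ℝ × ℝ => deriv φ z.1 • f z.2)
      ((intervalMeasure a b).prod (intervalMeasure a b)) := (hφ'.smul_prod hf).indicator hS
  have h1 : ∀ x ∈ Set.Ioo a b, ∫ t in Set.Ioo a b, S.indicator (fun z => deriv φ z.1 • f z.2) (x, t)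
      = deriv φ x • primitive a f x := by
    intro x hx
    have : ∀ t, S.indicator (fun z => deriv φ z.1 • f z.2) (x, t) =
        (Set.Iio x).indicator (fun t => deriv φ x • f t) t := fun t => rfl
    simp_rw [this]
    rw [setIntegral_indicator measurableSet_Iio, integral_smul, primitive, Set.Ioo_inter_Iio,
      min_eq_right hx.2.le]
  have h2 : ∀ t ∈ Set.Ioo a b, ∫ x in Set.Ioo a b, S.indicator (fun z => deriv φ z.1 • f z.2) (x, t)
      = -(φ t • f t) := by
    intro t ht
    have : ∀ x, S.indicator (fun z => deriv φ z.1 • f z.2) (x, t) =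
        (Set.Ioi t).indicator (fun x => deriv φ x • f t) x := fun t => rfl
    simp_rw [this]
    rw [setIntegral_indicator measurableSet_Ioi, integral_smul_const, Set.Ioo_inter_Ioi,
      max_eq_right ht.1.le, hφ.setIntegral_deriv ht.2.le, neg_smul]
  rw [← setIntegral_congr_fun measurableSet_Ioo h1, ← integral_neg,
    ← setIntegral_congr_fun measurableSet_Ioo h2]
  exact integral_integral_swap hSint

theorem IsWeakDeriv.succ_of_one {j : ℕ} {u v g : ℝ → 𝕜} (huv : IsWeakDeriv a b 1 u v)
    (hvg : IsWeakDeriv a b j v g) : IsWeakDeriv a b (j + 1) u g := by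
  intro φ hφ
  have h := huv _ (hφ.iteratedDeriv j)
  rw [iteratedDeriv_one, ← iteratedDeriv_succ, hvg φ hφ] at h
  rw [h, pow_succ']
  ring

theorem isWeakDeriv_zero (u : ℝ → 𝕜) : IsWeakDeriv a b 0 u u := by
  intro φ _
  simp

variable {p : ENNReal}

theorem exists_eLpNorm_primitive_le (hp : 1 ≤ p) : ∃ C : NNReal, ∀ f : ℝ → 𝕜,
    MemLp f p (intervalMeasure a b) → MemLp (primitive a f) p (intervalMeasure a b) ∧
      eLpNorm (primitive a f) p (intervalMeasure a b) ≤
        C * eLpNorm f p (intervalMeasure a b) := by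
  -- The bound factors as $L_p\to L_1\to L_\infty\to L_p$: `e₂` and `e₁` are the Hölder constants of
  -- the first and last inclusions, and the primitive in the middle has norm at most 1.
  let e₁ := intervalMeasure a b Set.univ ^ (1 / p.toReal - 1 / (⊤ : ENNReal).toReal)
  let e₂ := intervalMeasure a b Set.univ ^ (1 / (1 : ENNReal).toReal - 1 / p.toReal)
  have he₁ : e₁ ≠ ⊤ := ENNReal.rpow_ne_top_of_nonneg (by simp) (measure_ne_top _ _)
  have he₂ : e₂ ≠ ⊤ := by
    refine ENNReal.rpow_ne_top_of_nonneg ?_ (measure_ne_top _ _)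
    rcases eq_or_ne p ⊤ with rfl | h
    · simp
    · have : 1 ≤ p.toReal := by simpa using ENNReal.toReal_mono h hp
      simpa using inv_le_one_of_one_le₀ this
  refine ⟨(e₂ * e₁).toNNReal, fun f hf => ?_⟩
  have hm := aestronglyMeasurable_primitive (hf.integrable hp)
  have hle : eLpNorm (primitive a f) p (intervalMeasure a b) ≤
      ((e₂ * e₁).toNNReal : ENNReal) * eLpNorm f p (intervalMeasure a b) := by
    rw [ENNReal.coe_toNNReal (ENNReal.mul_ne_top he₂ he₁), mul_comm, ← mul_assoc]
    refine (eLpNorm_le_eLpNorm_mul_rpow_measure_univ le_top hm).trans ?_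
    gcongr
    refine (eLpNorm_primitive_top_le f).trans ?_
    exact eLpNorm_le_eLpNorm_mul_rpow_measure_univ hp hf.1
  exact ⟨⟨hm, hle.trans_lt (ENNReal.mul_lt_top ENNReal.coe_lt_top hf.2)⟩, hle⟩

theorem memLp_primitive_iterate (hp : 1 ≤ p) {f : ℝ → 𝕜} (hf : MemLp f p (intervalMeasure a b))
    (j : ℕ) : MemLp ((primitive a)^[j] f) p (intervalMeasure a b) := by
  induction j with
  | zero => exact hf
  | succ j ih =>
    rw [Function.iterate_succ_apply']
    exact ((exists_eLpNorm_primitive_le hp).choose_spec _ ih).1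

theorem exists_eLpNorm_primitive_iterate_le (𝕜 : Type*) [RCLike 𝕜] (a b : ℝ) (hp : 1 ≤ p)
    (j : ℕ) : ∃ C : NNReal, ∀ f : ℝ → 𝕜, MemLp f p (intervalMeasure a b) →
      eLpNorm ((primitive a)^[j] f) p (intervalMeasure a b) ≤
        C * eLpNorm f p (intervalMeasure a b) := by
  obtain ⟨C, hC⟩ := exists_eLpNorm_primitive_le (𝕜 := 𝕜) (a := a) (b := b) hp
  refine ⟨C ^ j, fun f hf => ?_⟩
  induction j with
  | zero => simp
  | succ j ih =>
    rw [Function.iterate_succ_apply']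
    refine (hC _ (memLp_primitive_iterate hp hf j)).2.trans ?_
    rw [pow_succ', ENNReal.coe_mul, mul_assoc]
    gcongr

theorem isWeakDeriv_primitive_iterate (hp : 1 ≤ p) {f : ℝ → 𝕜}
    (hf : MemLp f p (intervalMeasure a b)) (i j : ℕ) :
    IsWeakDeriv a b j ((primitive a)^[i + j] f) ((primitive a)^[i] f) := by
  induction j with
  | zero => exact isWeakDeriv_zero _
  | succ j ih =>
    refine IsWeakDeriv.succ_of_one ?_ ih
    rw [← add_assoc, Function.iterate_succ_apply']
    exact isWeakDeriv_one_primitive ((memLp_primitive_iterate hp hf _).integrable hp)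

theorem primitive_congr {f g : ℝ → 𝕜} (h : f =ᵐ[intervalMeasure a b] g) {x : ℝ} (hx : x ≤ b) :
    primitive a f x = primitive a g x :=
  integral_congr_ae (ae_restrict_of_ae_restrict_of_subset (Set.Ioo_subset_Ioo_right hx) h)

theorem primitive_iterate_congr {f g : ℝ → 𝕜} (h : f =ᵐ[intervalMeasure a b] g) (j : ℕ) :
    (primitive a)^[j] f =ᵐ[intervalMeasure a b] (primitive a)^[j] g := by
  induction j with
  | zero => exact h
  | succ j ih =>
    rw [Function.iterate_succ_apply', Function.iterate_succ_apply']
    filter_upwards [ae_restrict_mem measurableSet_Ioo] with x hx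
    exact primitive_congr ih hx.2.le

theorem primitive_iterate_add (hp : 1 ≤ p) {f g : ℝ → 𝕜} (hf : MemLp f p (intervalMeasure a b))
    (hg : MemLp g p (intervalMeasure a b)) (j : ℕ) :
    (primitive a)^[j] (f + g) =ᵐ[intervalMeasure a b]
      (primitive a)^[j] f + (primitive a)^[j] g := by
  induction j with
  | zero => rfl
  | succ j ih =>
    simp only [Function.iterate_succ_apply']
    filter_upwards [ae_restrict_mem measurableSet_Ioo] with x hx
    rw [primitive_congr ih hx.2.le]
    have hsub : Set.Ioo a x ⊆ Set.Ioo a b := Set.Ioo_subset_Ioo_right hx.2.le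
    exact integral_add
      (IntegrableOn.mono_set ((memLp_primitive_iterate hp hf j).integrable hp) hsub)
      (IntegrableOn.mono_set ((memLp_primitive_iterate hp hg j).integrable hp) hsub)

theorem primitive_iterate_smul (c : 𝕜) (f : ℝ → 𝕜) (j : ℕ) :
    (primitive a)^[j] (c • f) = c • (primitive a)^[j] f := by
  induction j with
  | zero => rfl
  | succ j ih =>
    simp only [Function.iterate_succ_apply', ih]
    ext x
    exact integral_smul c _

end Primitive

/-! ### The subspace $Y$ and the transfer from $L_p$ to $W^{m,p}$ -/

section HigherIntegrability

variable {𝕜 : Type*} [RCLike 𝕜] {m : ℕ} {p q : ENNReal} {a b : ℝ}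

theorem MemSobolev.mono_exponent {u : ℝ → 𝕜} (h : MemSobolev m q a b u) (hpq : p ≤ q) :
    MemSobolev m p a b u := by
  refine ⟨h.1.mono_exponent hpq, fun j hj => ?_⟩
  obtain ⟨g, hg, hug⟩ := h.2 j hj
  exact ⟨g, hg.mono_exponent hpq, hug⟩

theorem MemSobolev.congr {u v : ℝ → 𝕜} (h : MemSobolev m p a b u)
    (huv : u =ᵐ[intervalMeasure a b] v) : MemSobolev m p a b v := by
  refine ⟨(memLp_congr_ae huv).1 h.1, fun j hj => ?_⟩
  obtain ⟨g, hg, hug⟩ := h.2 j hj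
  exact ⟨g, hg, hug.congr huv Filter.EventuallyEq.rfl⟩

theorem MemSobolev.add (hp : 1 ≤ p) {u v : ℝ → 𝕜} (hu : MemSobolev m p a b u)
    (hv : MemSobolev m p a b v) : MemSobolev m p a b (u + v) := by
  refine ⟨hu.1.add hv.1, fun j hj => ?_⟩
  obtain ⟨g, hg, hug⟩ := hu.2 j hj
  obtain ⟨h, hh, hvh⟩ := hv.2 j hj
  exact ⟨g + h, hg.add hh, IsWeakDeriv.add hp hu.1 hv.1 hg hh hug hvh⟩

theorem MemSobolev.const_smul (c : 𝕜) {u : ℝ → 𝕜} (hu : MemSobolev m p a b u) :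
    MemSobolev m p a b (c • u) := by
  refine ⟨hu.1.const_smul c, fun j hj => ?_⟩
  obtain ⟨g, hg, hug⟩ := hu.2 j hj
  exact ⟨c • g, hg.const_smul c, hug.const_smul c⟩

theorem isWeakDeriv_const (hab : a < b) (c : 𝕜) {j : ℕ} (hj : j ≠ 0) :
    IsWeakDeriv a b j (fun _ => c) 0 := by
  obtain ⟨j, rfl⟩ := Nat.exists_eq_succ_of_ne_zero hj
  intro φ hφ
  have ha : iteratedDeriv j φ a = 0 := image_eq_zero_of_notMem_tsupport fun h =>
    lt_irrefl a ((hφ.iteratedDeriv j).tsupport_subset h).1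
  rw [integral_smul_const, Nat.succ_eq_add_one, iteratedDeriv_succ,
    (hφ.iteratedDeriv j).setIntegral_deriv hab.le, ha]
  simp

theorem memSobolev_const (hab : a < b) (c : 𝕜) : MemSobolev m p a b (fun _ => c) :=
  ⟨memLp_const c, fun _ hj =>
    ⟨0, MemLp.zero, isWeakDeriv_const hab c (Nat.one_le_iff_ne_zero.1 (Finset.mem_Icc.1 hj).1)⟩⟩

namespace SobolevSpace

variable [hp : Fact (1 ≤ p)]

/-- An element of `L_p(a, b)` as an element of `W^{m,p}(a, b)`. -/
def ofLp (u : Lp 𝕜 p (intervalMeasure a b)) (h : MemSobolev m p a b (u : ℝ → 𝕜)) :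
    SobolevSpace 𝕜 m p a b :=
  (⟨u, h⟩ : sobolevSubmodule 𝕜 m p a b)

@[simp]
theorem toLp_ofLp (u : Lp 𝕜 p (intervalMeasure a b)) (h : MemSobolev m p a b (u : ℝ → 𝕜)) :
    toLp (ofLp u h) = u := rfl

variable (𝕜 m p a b) in
/-- The elements of `W^{m,p}(a, b)` which are in `W^{m,q}(a, b)` for some `q ∈ (p, ∞)`
(with `0` added, which matters for `p = ∞` only). -/
def higherIntegrable : Submodule 𝕜 (SobolevSpace 𝕜 m p a b) where
  carrier := {u | ∃ q ∈ Set.Ioo p ⊤, MemSobolev m q a b (toLp u : ℝ → 𝕜)} ∪ {0}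
  zero_mem' := Or.inr rfl
  add_mem' := by
    rintro u v (⟨q, hq, hu⟩ | hu) (⟨r, hr, hv⟩ | hv)
    -- Both summands lie in the Sobolev space with the smaller exponent, which is still above `p`.
    · refine Or.inl ⟨min q r, ⟨lt_min hq.1 hr.1, (min_le_left _ _).trans_lt hq.2⟩, ?_⟩
      rw [map_add]
      exact (MemSobolev.add (hp.out.trans (le_min hq.1.le hr.1.le))
        (hu.mono_exponent (min_le_left _ _)) (hv.mono_exponent (min_le_right _ _))).congr
        (Lp.coeFn_add _ _).symm
    · rw [Set.mem_singleton_iff.1 hv, add_zero]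
      exact Or.inl ⟨q, hq, hu⟩
    · rw [Set.mem_singleton_iff.1 hu, zero_add]
      exact Or.inl ⟨r, hr, hv⟩
    · rw [Set.mem_singleton_iff.1 hu, zero_add]
      exact Or.inr hv
  smul_mem' := by
    rintro c u (⟨q, hq, hu⟩ | hu)
    · refine Or.inl ⟨q, hq, ?_⟩
      rw [map_smul]
      exact (hu.const_smul c).congr (Lp.coeFn_smul _ _).symm
    · rw [Set.mem_singleton_iff.1 hu, smul_zero]
      exact Or.inr rfl

theorem mem_higherIntegrable {u : SobolevSpace 𝕜 m p a b} :
    u ∈ higherIntegrable 𝕜 m p a b ↔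
      (∃ q ∈ Set.Ioo p ⊤, MemSobolev m q a b (toLp u : ℝ → 𝕜)) ∨ u = 0 := Iff.rfl

theorem memSobolev_primitive_iterate (f : Lp 𝕜 p (intervalMeasure a b)) :
    MemSobolev m p a b ((primitive a)^[m] f) := by
  refine ⟨memLp_primitive_iterate hp.out (Lp.memLp f) m, fun j hj => ?_⟩
  refine ⟨_, memLp_primitive_iterate hp.out (Lp.memLp f) (m - j), ?_⟩
  have h := isWeakDeriv_primitive_iterate hp.out (Lp.memLp f) (m - j) j
  rwa [Nat.sub_add_cancel (Finset.mem_Icc.1 hj).2] at h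

variable (𝕜 m p a b) in
/-- The `m`-fold primitive, as a linear map from `L_p(a, b)` to `W^{m,p}(a, b)`. -/
noncomputable def iteratedPrimitive :
    Lp 𝕜 p (intervalMeasure a b) →ₗ[𝕜] SobolevSpace 𝕜 m p a b where
  toFun f := ofLp ((memLp_primitive_iterate hp.out (Lp.memLp f) m).toLp _)
    ((memSobolev_primitive_iterate f).congr (MemLp.coeFn_toLp _).symm)
  map_add' f g := by
    apply toLp_injective
    rw [map_add, toLp_ofLp, toLp_ofLp, toLp_ofLp, ← MemLp.toLp_add]
    exact MemLp.toLp_congr _ _ ((primitive_iterate_congr (Lp.coeFn_add f g) m).trans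
      (primitive_iterate_add hp.out (Lp.memLp f) (Lp.memLp g) m))
  map_smul' c f := by
    apply toLp_injective
    rw [RingHom.id_apply, map_smul, toLp_ofLp, toLp_ofLp, ← MemLp.toLp_const_smul]
    refine MemLp.toLp_congr _ _ ((primitive_iterate_congr (Lp.coeFn_smul c f) m).trans ?_)
    rw [primitive_iterate_smul]

theorem toLp_iteratedPrimitive (f : Lp 𝕜 p (intervalMeasure a b)) :
    toLp (iteratedPrimitive 𝕜 m p a b f) =
      (memLp_primitive_iterate hp.out (Lp.memLp f) m).toLp _ := rfl

theorem isWeakDeriv_toLp_iteratedPrimitive {j : ℕ} (hj : j ≤ m)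
    (f : Lp 𝕜 p (intervalMeasure a b)) :
    IsWeakDeriv a b j (toLp (iteratedPrimitive 𝕜 m p a b f)) ((primitive a)^[m - j] f) := by
  have h := isWeakDeriv_primitive_iterate hp.out (Lp.memLp f) (m - j) j
  rw [Nat.sub_add_cancel hj] at h
  refine h.congr ?_ Filter.EventuallyEq.rfl
  rw [toLp_iteratedPrimitive]
  exact (MemLp.coeFn_toLp _).symm

theorem weakDeriv_iteratedPrimitive {j : ℕ} (hj : j ∈ Finset.Icc 1 m)
    (f : Lp 𝕜 p (intervalMeasure a b)) :
    weakDeriv j (iteratedPrimitive 𝕜 m p a b f) =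
      (memLp_primitive_iterate hp.out (Lp.memLp f) (m - j)).toLp _ :=
  weakDeriv_eq hj ((isWeakDeriv_toLp_iteratedPrimitive (Finset.mem_Icc.1 hj).2 f).congr
    Filter.EventuallyEq.rfl (MemLp.coeFn_toLp _).symm)

/-- The weak derivative of order `m` gives back `f`, and its norm is one summand of the Sobolev
norm; for `m = 0` the function itself plays this role. -/
theorem norm_le_norm_iteratedPrimitive (f : Lp 𝕜 p (intervalMeasure a b)) :
    ‖f‖ ≤ ‖iteratedPrimitive 𝕜 m p a b f‖ := by
  rw [norm_def]
  rcases Nat.eq_zero_or_pos m with rfl | hm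
  · rw [toLp_iteratedPrimitive]
    simp
  · have hm' : m ∈ Finset.Icc 1 m := Finset.mem_Icc.2 ⟨hm, le_rfl⟩
    have h1 : weakDeriv m (iteratedPrimitive 𝕜 m p a b f) = f := by
      refine weakDeriv_eq hm' ?_
      simpa using isWeakDeriv_toLp_iteratedPrimitive le_rfl f
    have h2 := Finset.single_le_sum (s := Finset.Icc 1 m)
      (f := fun j => ‖weakDeriv j (iteratedPrimitive 𝕜 m p a b f)‖)
      (fun j _ => norm_nonneg _) hm'
    simp only [h1] at h2
    linarith [norm_nonneg (toLp (iteratedPrimitive 𝕜 m p a b f))]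

theorem exists_norm_iteratedPrimitive_le : ∃ C : ℝ, ∀ f : Lp 𝕜 p (intervalMeasure a b),
    ‖iteratedPrimitive 𝕜 m p a b f‖ ≤ C * ‖f‖ := by
  choose C hC using exists_eLpNorm_primitive_iterate_le 𝕜 a b hp.out
  have key : ∀ j (f : Lp 𝕜 p (intervalMeasure a b)),
      ‖(memLp_primitive_iterate hp.out (Lp.memLp f) j).toLp _‖ ≤ C j * ‖f‖ := by
    intro j f
    rw [Lp.norm_toLp, Lp.norm_def, ← ENNReal.coe_toReal (C j), ← ENNReal.toReal_mul]
    exact ENNReal.toReal_mono (ENNReal.mul_ne_top ENNReal.coe_ne_top (Lp.eLpNorm_ne_top f))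
      (hC j f (Lp.memLp f))
  refine ⟨C m + ∑ j ∈ Finset.Icc 1 m, (C (m - j) : ℝ), fun f => ?_⟩
  rw [norm_def, add_mul, Finset.sum_mul]
  refine add_le_add (key m f) (Finset.sum_le_sum fun j hj => ?_)
  rw [weakDeriv_iteratedPrimitive hj]
  exact key (m - j) f

/-- The two norm bounds make the map bi-Lipschitz onto its range, which is closed because $L_p$ is
complete; completeness of $W^{m,p}$ is not needed. -/
theorem isClosedEmbedding_iteratedPrimitive :
    Topology.IsClosedEmbedding (iteratedPrimitive 𝕜 m p a b) := by
  obtain ⟨C, hC⟩ := exists_norm_iteratedPrimitive_le (𝕜 := 𝕜) (m := m) (p := p) (a := a) (b := b)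
  have h1 : UniformContinuous ((iteratedPrimitive 𝕜 m p a b).mkContinuous C hC) :=
    ContinuousLinearMap.uniformContinuous _
  have h2 : AntilipschitzWith 1 (iteratedPrimitive 𝕜 m p a b) :=
    AddMonoidHomClass.antilipschitz_of_bound _ fun f => by
      simpa using norm_le_norm_iteratedPrimitive f
  exact h2.isClosedEmbedding h1

/-- If the `m`-fold primitive of `f` is in `W^{m,q}(a, b)`, then `f ∈ L_q(a, b)`. -/
theorem memLp_of_memSobolev_iteratedPrimitive (hq : 1 ≤ q) {f : Lp 𝕜 p (intervalMeasure a b)}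
    (h : MemSobolev m q a b (toLp (iteratedPrimitive 𝕜 m p a b f) : ℝ → 𝕜)) :
    MemLp f q (intervalMeasure a b) := by
  have h1 : ∃ g, MemLp g q (intervalMeasure a b) ∧
      IsWeakDeriv a b m (toLp (iteratedPrimitive 𝕜 m p a b f)) g := by
    rcases Nat.eq_zero_or_pos m with rfl | hm
    · exact ⟨_, h.1, isWeakDeriv_zero _⟩
    · exact h.2 m (Finset.mem_Icc.2 ⟨hm, le_rfl⟩)
  obtain ⟨g, hg, hug⟩ := h1
  have h2 := isWeakDeriv_toLp_iteratedPrimitive le_rfl f (m := m)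
  rw [Nat.sub_self, Function.iterate_zero_apply] at h2
  -- `g` is in $L_q$ and `f` in $L_p$; uniqueness of the weak derivative is applied in $L_1$, which
  -- contains both.
  exact (memLp_congr_ae (IsWeakDeriv.unique le_rfl (hg.mono_exponent hq)
    ((Lp.memLp f).mono_exponent hp.out) hug h2)).1 hg

/-- The constant function 1 lies in $W^{m,q}$ for every $q$. -/
theorem higherIntegrable_ne_bot (hab : a < b) (hp' : p ≠ ⊤) :
    higherIntegrable 𝕜 m p a b ≠ ⊥ := by
  have hc : MemLp (fun _ => (1 : 𝕜)) p (intervalMeasure a b) := memLp_const 1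
  have hS : ∀ q, MemSobolev m q a b (hc.toLp _ : ℝ → 𝕜) := fun q =>
    (memSobolev_const hab 1).congr hc.coeFn_toLp.symm
  obtain ⟨q, hq⟩ := exists_between (lt_top_iff_ne_top.2 hp')
  refine (Submodule.ne_bot_iff _).2 ⟨ofLp (hc.toLp _) (hS p), Or.inl ⟨q, hq, hS q⟩, fun h => ?_⟩
  have h0 : hc.toLp _ = 0 := congrArg toLp h
  have h1 : (fun _ : ℝ => (1 : 𝕜)) =ᵐ[intervalMeasure a b] 0 :=
    (MemLp.toLp_eq_toLp_iff hc MemLp.zero).1 h0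
  have hne : intervalMeasure a b ≠ 0 := by
    rw [Ne, Measure.restrict_eq_zero, Real.volume_Ioo, ENNReal.ofReal_eq_zero]
    linarith
  have := ae_neBot.2 hne
  obtain ⟨x, hx⟩ := h1.exists
  exact one_ne_zero hx

/-- There is a closed subspace of `W^{m,p}(a, b)` of dimension `𝔠` no nonzero element of which is in
`W^{m,q}(a, b)` for any `q ∈ (p, ∞)`. -/
theorem exists_isClosed_disjoint_higherIntegrable (hab : a < b) (hp' : p ≠ ⊤) :
    ∃ H : Submodule 𝕜 (SobolevSpace 𝕜 m p a b), IsClosed (H : Set (SobolevSpace 𝕜 m p a b)) ∧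
      Module.rank 𝕜 H = Cardinal.continuum ∧ Disjoint H (higherIntegrable 𝕜 m p a b) := by
  obtain ⟨κ, hκ, hμ⟩ := exists_measurable_nat_intervalMeasure_preimage hab
  have hd := sub_pos.2 hab
  have hinj := (isClosedEmbedding_iteratedPrimitive (𝕜 := 𝕜) (m := m) (p := p) (a := a)
    (b := b)).injective
  refine ⟨(LinearMap.range (stepLp 𝕜 κ p (intervalMeasure a b))).map
    (iteratedPrimitive 𝕜 m p a b), ?_, ?_, ?_⟩
  · rw [Submodule.map_coe]
    exact isClosedEmbedding_iteratedPrimitive.isClosedMap _ (isClosed_range_stepLp hd hμ)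
  · rw [← (Submodule.equivMapOfInjective _ hinj _).rank_eq,
      rank_range_of_injective _ (stepLp_injective hd hμ), rank_stepSequences hp.out hp' hκ hd hμ]
  · rw [Submodule.disjoint_def]
    rintro _ ⟨_, ⟨c, rfl⟩, rfl⟩ (⟨q, hq, h⟩ | h)
    · have hc := memLp_of_memSobolev_iteratedPrimitive (hp.out.trans hq.1.le) h
      rw [eq_zero_of_memLp_stepLp hp.out hq.1 hq.2.ne hκ hd hμ hc, map_zero, map_zero]
    · exact h

end SobolevSpace

end HigherIntegrability

/-! ### The main theorem -/

theorem mainTheorem10 {𝕜 : Type*} [RCLike 𝕜] (m : ℕ) (a b : ℝ) (hab : a < b)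
    (p : ENNReal) [Fact (1 ≤ p)] (hp : p ≠ ⊤) (α : Cardinal) :
    IsPairSpaceable 𝕜 α Cardinal.continuum
      ((Set.univ : Set (SobolevSpace 𝕜 m p a b)) \
        ⋃ q ∈ Set.Ioo p ⊤,
          {u : SobolevSpace 𝕜 m p a b | MemSobolev m q a b (SobolevSpace.toLp u : ℝ → 𝕜)})
      ↔ α < Cardinal.aleph0 := by
  obtain ⟨H, hHc, hHr, hHY⟩ :=
    SobolevSpace.exists_isClosed_disjoint_higherIntegrable (𝕜 := 𝕜) (m := m) hab hp
  rw [← isPairSpaceable_compl_submodule_iff Cardinal.aleph0_le_continuum hHc hHr hHY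
    (SobolevSpace.higherIntegrable_ne_bot hab hp) α]
  have hset : (Set.univ : Set (SobolevSpace 𝕜 m p a b)) \ ⋃ q ∈ Set.Ioo p ⊤,
      {u : SobolevSpace 𝕜 m p a b | MemSobolev m q a b (SobolevSpace.toLp u : ℝ → 𝕜)} =
      (SobolevSpace.higherIntegrable 𝕜 m p a b : Set (SobolevSpace 𝕜 m p a b))ᶜ := by
    -- As `p` is finite, some exponent `q` is available, so the zero adjoined in `higherIntegrable`
    -- is already in the union.
    obtain ⟨q, hq⟩ := exists_between (lt_top_iff_ne_top.2 hp)
    have h0 : MemSobolev m q a b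
        (SobolevSpace.toLp (0 : SobolevSpace 𝕜 m p a b) : ℝ → 𝕜) := by
      rw [map_zero]
      exact (memSobolev_const hab 0).congr (Lp.coeFn_zero _ _ _).symm
    rw [← Set.compl_eq_univ_sdiff, compl_inj_iff]
    ext u
    rw [SetLike.mem_coe, SobolevSpace.mem_higherIntegrable]
    simp only [Set.mem_iUnion, exists_prop, Set.mem_ofPred_eq]
    refine ⟨Or.inl, ?_⟩
    rintro (h | rfl)
    · exact h
    · exact ⟨q, hq, h0⟩
  rw [hset]
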